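/- Let $M$ be a smooth manifold (finite- or infinite-dimensional) modelled on a convenient vector space $E$, i.e. a Hausdorff locally convex real topological vector space in which every smooth curve has a smooth antiderivative (for instance a Banach or Fréchet space); a map is smooth if it takes smooth curves to smooth curves. Let $TM$ be the kinematic tangent bundle of $M$, and let $\xi\subset TM$ be a distribution of codimension one, i.e. a vector subbundle of $TM$ (locally, in suitable smooth trivializations of $TM$, of the form $U\times F\subset U\times E$ with $F$ a closed complemented subspace of $E$) such that $\dim T_xM/\xi_x=1$ for every $x\in M$. Then $\xi$ is co-orientable, meaning that the quotient vector bundle $TM/\xi$ is trivial, if and only if there is a smooth 1-form $\alpha\in\Omega^1(M)$ with $\alpha_x\neq 0$ for every $x\in M$ and $\xi=\ker\alpha$, i.e. $\xi_x=\ker\alpha_x$ for every $x\in M$. -/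

import Mathlib

open Filter Topology Set

universe u v

/-! ### Smooth curves, smooth maps, convenient vector spaces -/

section Curves

variable {E : Type*} [AddCommGroup E] [Module ℝ E] [TopologicalSpace E]
variable {F : Type*} [AddCommGroup F] [Module ℝ F] [TopologicalSpace F]

/-- At every `t ∈ J` the difference quotient of the curve `c` converges to `c' t`.
In all uses `J` is an open set of parameters. -/
def HasCurveDerivOn (c c' : ℝ → E) (J : Set ℝ) : Prop :=
  ∀ t ∈ J, Tendsto (fun δ : ℝ => δ⁻¹ • (c (t + δ) - c t)) (𝓝[≠] 0) (𝓝 (c' t))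

/-- The curve `c` is of class `C^n` on the open set `J`. -/
def CnCurveOn : ℕ → (ℝ → E) → Set ℝ → Prop
  | 0, c, J => ContinuousOn c J
  | n + 1, c, J => ContinuousOn c J ∧ ∃ c' : ℝ → E, HasCurveDerivOn c c' J ∧ CnCurveOn n c' J

/-- The curve `c` is smooth on the open set `J`. -/
def SmoothCurveOn (c : ℝ → E) (J : Set ℝ) : Prop := ∀ n : ℕ, CnCurveOn n c J

/-- Smooth curves `ℝ → E`. -/
def SmoothCurve (c : ℝ → E) : Prop := SmoothCurveOn c univ

/-- The derivative `c'(t)` of a curve (used only where the limit exists). -/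
noncomputable def curveDeriv (c : ℝ → E) (t : ℝ) : E :=
  haveI : Nonempty E := ⟨0⟩
  limUnder (𝓝[≠] (0 : ℝ)) (fun δ : ℝ => δ⁻¹ • (c (t + δ) - c t))

/-- A map `f : U → F`, `U ⊆ E` open, is smooth if it maps smooth curves to smooth curves. -/
def SmoothMapOn (f : E → F) (U : Set E) : Prop :=
  ∀ c : ℝ → E, SmoothCurve c → (∀ t, c t ∈ U) → SmoothCurve (f ∘ c)

variable (E) in
/-- A convenient vector space: a Hausdorff locally convex space in which every smooth curve has a
smooth antiderivative. -/
class ConvenientSpace : Prop extends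
    IsTopologicalAddGroup E, ContinuousSMul ℝ E, LocallyConvexSpace ℝ E, T2Space E where
  exists_antiderivative : ∀ c : ℝ → E, SmoothCurve c →
    ∃ C : ℝ → E, SmoothCurve C ∧ HasCurveDerivOn C c univ

end Curves

/-! ### Convenient manifolds and the kinematic tangent bundle -/

section Manifolds

variable (E : Type u) [AddCommGroup E] [Module ℝ E] [TopologicalSpace E]
variable (M : Type v) [TopologicalSpace M] [ChartedSpace E M]

/-- A manifold modelled on `E`: any two charts of the atlas are smoothly compatible. -/
class ConvenientManifold : Prop where
  smooth_transition : ∀ e ∈ atlas E M, ∀ e' ∈ atlas E M,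
    SmoothMapOn (e' ∘ e.symm) (e.symm.trans e').source

variable {M}

/-- Smooth paths in `M`: continuous, and smooth in every chart wherever this is defined. -/
def SmoothPath (γ : ℝ → M) : Prop :=
  Continuous γ ∧ ∀ e ∈ atlas E M, SmoothCurveOn (e ∘ γ) (γ ⁻¹' e.source)

/-- The kinematic tangent space `T_x M`. As for Mathlib's `TangentSpace`, a tangent vector is
recorded by its coordinate in the preferred chart at `x`: the class of a smooth path `c` with
`c 0 = x` is the vector `(chartAt E x ∘ c)'(0)` of `E`. -/
def KTangentSpace (_x : M) : Type u := E

instance (x : M) : AddCommGroup (KTangentSpace E x) := inferInstanceAs (AddCommGroup E)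
instance (x : M) : Module ℝ (KTangentSpace E x) := inferInstanceAs (Module ℝ E)
instance (x : M) : TopologicalSpace (KTangentSpace E x) := inferInstanceAs (TopologicalSpace E)

variable (M) in
/-- The total space of the kinematic tangent bundle `TM`. -/
abbrev KTangentBundle : Type (max u v) := Bundle.TotalSpace E (fun x : M => KTangentSpace E x)

variable {E}

/-- The fibre coordinate of a tangent vector `X` in the chart `e`, that is `(e ∘ c)'(0)` for a path
`c` representing `X`; the path used here is a straight line in the preferred chart at the foot-point
of `X`. The bundle chart of `TM` over `e` is `X ↦ (e X.proj, tangentCoord e X)`. -/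
noncomputable def tangentCoord (e : OpenPartialHomeomorph M E) (X : KTangentBundle E M) : E :=
  curveDeriv (fun s : ℝ =>
    e ((chartAt E X.proj).symm (chartAt E X.proj X.proj + s • (show E from X.snd)))) 0

/-- Smooth paths in `TM`: smooth in every bundle chart of `TM`. -/
def SmoothTangentPath (X : ℝ → KTangentBundle E M) : Prop :=
  SmoothPath E (fun t => (X t).proj) ∧
    ∀ e ∈ atlas E M,
      SmoothCurveOn (fun t => tangentCoord e (X t)) {t | (X t).proj ∈ e.source}

variable (E M) in
/-- A (kinematic) 1-form: a choice of continuous linear functional on every tangent space which is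
smooth, as a function on `TM`, that is, it maps smooth paths in `TM` to smooth functions. -/
structure KOneForm where
  toFun : ∀ x : M, KTangentSpace E x →L[ℝ] ℝ
  smooth : ∀ X : ℝ → KTangentBundle E M, SmoothTangentPath X →
    SmoothCurve (fun t => toFun (X t).proj (X t).snd)

/-! ### Distributions and the quotient bundle -/

/-- A local trivialization of the vector bundle `TM` over an open set `U` which takes the subspaces
`ξ x ⊆ T_x M` to a fixed subspace `F` of `E`. The values of `triv` outside of `U` are irrelevant. -/
structure AdaptedTrivialization (ξ : ∀ x : M, Submodule ℝ (KTangentSpace E x)) where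
  U : Set M
  isOpen_U : IsOpen U
  F : Submodule ℝ E
  complemented_F : F.ClosedComplemented
  triv : ∀ x : M, KTangentSpace E x ≃L[ℝ] E
  /-- `triv` and its inverse are smooth as maps between `TM|_U` and `U × E`. -/
  smooth_iff : ∀ X : ℝ → KTangentBundle E M, SmoothPath E (fun t => (X t).proj) →
    (∀ t, (X t).proj ∈ U) →
      (SmoothTangentPath X ↔ SmoothCurve (fun t => triv (X t).proj (X t).snd))
  mem_iff : ∀ x ∈ U, ∀ w : KTangentSpace E x, w ∈ ξ x ↔ triv x w ∈ F

variable (E M) in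
/-- A distribution: a vector subbundle `ξ ⊆ TM`. -/
structure KDistribution where
  fibre : ∀ x : M, Submodule ℝ (KTangentSpace E x)
  locally_trivial : ∀ x : M, ∃ T : AdaptedTrivialization fibre, x ∈ T.U

open Classical in
/-- The local trivialization of the quotient bundle `TM/ξ` induced by an adapted trivialization of
`TM`: over `x ∈ U` it is the induced map `T_x M / ξ x → E / F`. -/
noncomputable def AdaptedTrivialization.quotCoord
    {ξ : ∀ x : M, Submodule ℝ (KTangentSpace E x)} (T : AdaptedTrivialization ξ) (x : M) :
    (KTangentSpace E x ⧸ ξ x) →ₗ[ℝ] E ⧸ T.F :=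
  if hx : x ∈ T.U then
    Submodule.mapQ (ξ x) T.F (T.triv x).toLinearEquiv.toLinearMap
      (fun w hw => (T.mem_iff x hx w).1 hw)
  else 0

namespace KDistribution

/-- The fibre of the quotient bundle `TM/ξ`. -/
abbrev Quot (ξ : KDistribution E M) (x : M) : Type u := KTangentSpace E x ⧸ ξ.fibre x

/-- Smoothness of the path `t ↦ y t ∈ T_{γ t} M / ξ (γ t)` in the quotient bundle `TM/ξ`: it is
smooth in the local trivializations of `TM/ξ`. -/
def SmoothQuotPath (ξ : KDistribution E M) (γ : ℝ → M) (y : ∀ t, ξ.Quot (γ t)) : Prop :=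
  SmoothPath E γ ∧ ∀ T : AdaptedTrivialization ξ.fibre,
    SmoothCurveOn (fun t => T.quotCoord (γ t) (y t)) (γ ⁻¹' T.U)

/-- A global trivialization of the quotient bundle: an isomorphism `TM/ξ ≅ M × G` of vector bundles
over `M`, smooth together with its inverse. -/
structure QuotTrivialization (ξ : KDistribution E M) (G : Type u)
    [AddCommGroup G] [Module ℝ G] [TopologicalSpace G] where
  equiv : ∀ x : M, ξ.Quot x ≃L[ℝ] G
  smooth_iff : ∀ (γ : ℝ → M) (y : ∀ t, ξ.Quot (γ t)), SmoothPath E γ →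
    (ξ.SmoothQuotPath γ y ↔ SmoothCurve (fun t => equiv (γ t) (y t)))

/-- `ξ` is co-orientable: the quotient bundle `TM/ξ` is trivial. -/
def CoOrientable (ξ : KDistribution E M) : Prop :=
  ∃ (G : Type u) (_ : AddCommGroup G) (_ : Module ℝ G) (_ : TopologicalSpace G)
    (_ : IsTopologicalAddGroup G) (_ : ContinuousSMul ℝ G), Nonempty (ξ.QuotTrivialization G)

end KDistribution

end Manifolds

/-! ### Calculus of curves -/

section CurveCalculus

variable {E : Type*} [AddCommGroup E] [Module ℝ E] [TopologicalSpace E]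
variable {F : Type*} [AddCommGroup F] [Module ℝ F] [TopologicalSpace F]

/-! A 1-form with kernel `ξ` is fibrewise the same as an isomorphism from `TM/ξ` to a line; what
needs proof is that smoothness agrees on both sides. From a trivialization, the fibre `G` is a
Hausdorff line, hence a copy of `ℝ`, and the form is the composite of `TM → TM/ξ → G ≅ ℝ`.
Conversely, `KOneForm.smoothQuotPath_mk_iff` shows that a path of classes `[w t]` is smooth exactly
when `α (w t)` is. One direction lifts `E/F` to `E` by a continuous linear section, available
because `F` is complemented; the other writes `[w]` as `α(w)/b` times a fixed class, where `b` is a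
nonvanishing smooth function. -/

theorem HasCurveDerivOn.mono {c c' : ℝ → E} {J K : Set ℝ} (h : HasCurveDerivOn c c' J)
    (hK : K ⊆ J) : HasCurveDerivOn c c' K :=
  fun t ht => h t (hK ht)

theorem tendsto_const_add_nhds_zero (t : ℝ) : Tendsto (fun δ : ℝ => t + δ) (𝓝 0) (𝓝 t) := by
  have h : Continuous (fun δ : ℝ => t + δ) := by fun_prop
  simpa using h.tendsto 0

theorem HasCurveDerivOn.congr {c d c' d' : ℝ → E} {J : Set ℝ} (hJ : IsOpen J)
    (h : HasCurveDerivOn c c' J) (hc : EqOn c d J) (hc' : EqOn c' d' J) :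
    HasCurveDerivOn d d' J := by
  intro t ht
  rw [← hc' ht]
  refine (h t ht).congr' ?_
  have hev : ∀ᶠ δ in 𝓝[≠] (0 : ℝ), t + δ ∈ J :=
    ((tendsto_const_add_nhds_zero t).mono_left nhdsWithin_le_nhds).eventually (hJ.mem_nhds ht)
  filter_upwards [hev] with δ hδ
  rw [hc hδ, hc ht]

theorem HasCurveDerivOn.unique [T2Space E] {c c' d' : ℝ → E} {J K : Set ℝ}
    (h : HasCurveDerivOn c c' J) (h' : HasCurveDerivOn c d' K) {t : ℝ} (ht : t ∈ J)
    (ht' : t ∈ K) : c' t = d' t :=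
  tendsto_nhds_unique (h t ht) (h' t ht')

theorem CnCurveOn.continuousOn {n : ℕ} {c : ℝ → E} {J : Set ℝ} (h : CnCurveOn n c J) :
    ContinuousOn c J := by
  cases n with
  | zero => exact h
  | succ n => exact h.1

theorem CnCurveOn.mono {n : ℕ} {c : ℝ → E} {J K : Set ℝ} (h : CnCurveOn n c J) (hK : K ⊆ J) :
    CnCurveOn n c K := by
  induction n generalizing c with
  | zero => exact ContinuousOn.mono h hK
  | succ n ih =>
    obtain ⟨hc, c', hd, hc'⟩ := h
    exact ⟨hc.mono hK, c', hd.mono hK, ih hc'⟩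

theorem CnCurveOn.of_succ {n : ℕ} {c : ℝ → E} {J : Set ℝ} (h : CnCurveOn (n + 1) c J) :
    CnCurveOn n c J := by
  induction n generalizing c with
  | zero => exact h.1
  | succ n ih =>
    obtain ⟨hc, c', hd, hc'⟩ := h
    exact ⟨hc, c', hd, ih hc'⟩

theorem CnCurveOn.congr {n : ℕ} {c d : ℝ → E} {J : Set ℝ} (hJ : IsOpen J) (h : CnCurveOn n c J)
    (hcd : EqOn c d J) : CnCurveOn n d J := by
  cases n with
  | zero => exact ContinuousOn.congr h hcd.symm
  | succ n =>
    obtain ⟨hc, c', hd, hc'⟩ := h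
    exact ⟨hc.congr hcd.symm, c', hd.congr hJ hcd (fun _ _ => rfl), hc'⟩

/-- Limits in a Hausdorff space are unique, so local derivatives agree on overlaps and glue to the
diagonal choice `t ↦ c' t t`. -/
theorem CnCurveOn.of_locally [T2Space E] {n : ℕ} {c : ℝ → E} {J : Set ℝ}
    (h : ∀ t ∈ J, ∃ K, IsOpen K ∧ t ∈ K ∧ K ⊆ J ∧ CnCurveOn n c K) : CnCurveOn n c J := by
  induction n generalizing c with
  | zero =>
    intro t ht
    obtain ⟨K, hK, htK, -, hc⟩ := h t ht
    exact (ContinuousOn.continuousAt hc (hK.mem_nhds htK)).continuousWithinAt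
  | succ n ih =>
    choose! K hK hmem hKJ hc c' hd hc' using h
    exact ⟨fun t ht => ((hc t ht).continuousAt
      ((hK t ht).mem_nhds (hmem t ht))).continuousWithinAt, fun t => c' t t,
      fun t ht => hd t ht t (hmem t ht), ih fun t ht => ⟨K t, hK t ht, hmem t ht, hKJ t ht,
        (hc' t ht).congr (hK t ht) fun s hs =>
          (hd t ht).unique (hd s (hKJ t ht hs)) hs (hmem s (hKJ t ht hs))⟩⟩

theorem HasCurveDerivOn.map (L : E →L[ℝ] F) {c c' : ℝ → E} {J : Set ℝ}
    (h : HasCurveDerivOn c c' J) :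
    HasCurveDerivOn (fun t => L (c t)) (fun t => L (c' t)) J := by
  intro t ht
  have := (L.continuous.tendsto _).comp (h t ht)
  refine this.congr fun δ => ?_
  simp

theorem CnCurveOn.map (L : E →L[ℝ] F) {n : ℕ} {c : ℝ → E} {J : Set ℝ} (h : CnCurveOn n c J) :
    CnCurveOn n (fun t => L (c t)) J := by
  induction n generalizing c with
  | zero => exact L.continuous.comp_continuousOn h
  | succ n ih =>
    obtain ⟨hc, c', hd, hc'⟩ := h
    exact ⟨L.continuous.comp_continuousOn hc, _, hd.map L, ih hc'⟩

theorem CnCurveOn.const (n : ℕ) (v : E) (J : Set ℝ) : CnCurveOn n (fun _ => v) J := by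
  induction n generalizing v with
  | zero => exact continuousOn_const
  | succ n ih =>
    refine ⟨continuousOn_const, fun _ => 0, fun t _ => ?_, ih 0⟩
    simpa using tendsto_const_nhds

theorem HasCurveDerivOn.comp [ContinuousSMul ℝ E] {φ φ' : ℝ → ℝ} {c c' : ℝ → E} {J : Set ℝ}
    (hc : HasCurveDerivOn c c' J) (hφc : Continuous φ) (hφ : HasCurveDerivOn φ φ' univ) :
    HasCurveDerivOn (c ∘ φ) (fun t => φ' t • c' (φ t)) (φ ⁻¹' J) := by
  intro t ht
  -- `φ (t + δ) = φ t` may occur for `δ ≠ 0`, so the difference quotient of `c` is extended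
  -- continuously to increment zero.
  set q : ℝ → E := Function.update (fun s => s⁻¹ • (c (φ t + s) - c (φ t))) 0 (c' (φ t)) with hq
  have hqc : Tendsto q (𝓝 0) (𝓝 (c' (φ t))) := by
    have : ContinuousAt q 0 := continuousAt_update_same.2 (hc (φ t) ht)
    simpa [ContinuousAt, hq] using this
  have hΔ : Tendsto (fun δ => φ (t + δ) - φ t) (𝓝[≠] 0) (𝓝 0) := by
    have := ((hφc.tendsto t).comp (tendsto_const_add_nhds_zero t)).sub_const (φ t)
    simpa [Function.comp_def] using this.mono_left nhdsWithin_le_nhds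
  refine ((hφ t (mem_univ t)).smul (hqc.comp hΔ)).congr fun δ => ?_
  by_cases h0 : φ (t + δ) - φ t = 0
  · simp [sub_eq_zero.1 h0]
  · simp only [Function.comp_apply, hq, Function.update_of_ne h0, add_sub_cancel, smul_smul,
      smul_eq_mul]
    rw [mul_assoc, mul_inv_cancel₀ h0, mul_one]

section TopologicalModule

variable [IsTopologicalAddGroup E]

theorem CnCurveOn.add {n : ℕ} {c d : ℝ → E} {J : Set ℝ} (hc : CnCurveOn n c J)
    (hd : CnCurveOn n d J) : CnCurveOn n (fun t => c t + d t) J := by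
  induction n generalizing c d with
  | zero => exact ContinuousOn.add hc hd
  | succ n ih =>
    obtain ⟨hc, c', hcc, hc'⟩ := hc
    obtain ⟨hd, d', hdd, hd'⟩ := hd
    refine ⟨hc.add hd, fun t => c' t + d' t, fun t ht => ?_, ih hc' hd'⟩
    refine ((hcc t ht).add (hdd t ht)).congr fun δ => ?_
    rw [← smul_add, add_sub_add_comm]

variable [ContinuousSMul ℝ E]

theorem HasCurveDerivOn.smul {h h' : ℝ → ℝ} {c c' : ℝ → E} {J : Set ℝ} (hJ : IsOpen J)
    (hcont : ContinuousOn c J) (hh : HasCurveDerivOn h h' J) (hc : HasCurveDerivOn c c' J) :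
    HasCurveDerivOn (fun t => h t • c t) (fun t => h' t • c t + h t • c' t) J := by
  intro t ht
  have hct : Tendsto (fun δ => c (t + δ)) (𝓝[≠] 0) (𝓝 (c t)) :=
    (hcont.continuousAt (hJ.mem_nhds ht)).tendsto.comp
      ((tendsto_const_add_nhds_zero t).mono_left nhdsWithin_le_nhds)
  refine (((hh t ht).smul hct).add ((hc t ht).const_smul (h t))).congr fun δ => ?_
  simp only [smul_eq_mul]
  module

theorem CnCurveOn.smul {n : ℕ} {h : ℝ → ℝ} {c : ℝ → E} {J : Set ℝ} (hJ : IsOpen J)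
    (hh : CnCurveOn n h J) (hc : CnCurveOn n c J) : CnCurveOn n (fun t => h t • c t) J := by
  induction n generalizing h c with
  | zero => exact ContinuousOn.smul hh hc
  | succ n ih =>
    have hh₀ := hh.of_succ
    have hc₀ := hc.of_succ
    obtain ⟨hh, h', hhd, hh'⟩ := hh
    obtain ⟨hc, c', hcd, hc'⟩ := hc
    exact ⟨hh.smul hc, _, hhd.smul hJ hc hcd, (ih hh' hc₀).add (ih hh₀ hc')⟩

theorem CnCurveOn.comp {n : ℕ} {φ : ℝ → ℝ} {c : ℝ → E} {J : Set ℝ} (hJ : IsOpen J)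
    (hc : CnCurveOn n c J) (hφ : CnCurveOn n φ univ) : CnCurveOn n (c ∘ φ) (φ ⁻¹' J) := by
  induction n generalizing c with
  | zero => exact ContinuousOn.comp hc (ContinuousOn.mono hφ (subset_univ _)) fun _ h => h
  | succ n ih =>
    have hφ₀ := hφ.of_succ
    obtain ⟨hφ, φ', hφd, hφ'⟩ := hφ
    obtain ⟨hc, c', hcd, hc'⟩ := hc
    have hφc : Continuous φ := continuousOn_univ.1 hφ
    exact ⟨hc.comp hφc.continuousOn fun _ h => h, _, hcd.comp hφc hφd,
      (hφ'.mono (subset_univ _)).smul (hJ.preimage hφc) (ih hc' hφ₀)⟩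

end TopologicalModule

/-- The derivative is spelled with `•` so that the product rule for `CnCurveOn` applies to it in the
induction below. -/
theorem HasCurveDerivOn.inv {b b' : ℝ → ℝ} {J : Set ℝ} (hb : HasCurveDerivOn b b' J)
    (h0 : ∀ t ∈ J, b t ≠ 0) :
    HasCurveDerivOn (fun t => (b t)⁻¹) (fun t => (-1 : ℝ) • (b' t • ((b t)⁻¹ • (b t)⁻¹))) J := by
  intro t ht
  have := (hasDerivAt_iff_tendsto_slope_zero.2 (hb t ht)).fun_inv (h0 t ht)
  convert hasDerivAt_iff_tendsto_slope_zero.1 this using 2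
  have := h0 t ht
  simp only [smul_eq_mul]
  field_simp

theorem CnCurveOn.inv {n : ℕ} {b : ℝ → ℝ} {J : Set ℝ} (hJ : IsOpen J) (hb : CnCurveOn n b J)
    (h0 : ∀ t ∈ J, b t ≠ 0) : CnCurveOn n (fun t => (b t)⁻¹) J := by
  induction n with
  | zero => exact ContinuousOn.inv₀ hb h0
  | succ n ih =>
    have hi := ih hb.of_succ
    obtain ⟨hb, b', hbd, hb'⟩ := hb
    exact ⟨hb.inv₀ h0, _, hbd.inv h0,
      (CnCurveOn.const n (-1 : ℝ) J).smul hJ (hb'.smul hJ (hi.smul hJ hi))⟩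

/-! ### Localization: from curves on an open set to curves on the whole line -/

theorem ContDiff.smoothCurve {φ : ℝ → ℝ} (hφ : ContDiff ℝ (⊤ : ℕ∞) φ) : SmoothCurve φ := by
  intro n
  induction n generalizing φ with
  | zero => exact hφ.continuous.continuousOn
  | succ n ih =>
    obtain ⟨hd, hφ'⟩ := contDiff_infty_iff_deriv.1 hφ
    exact ⟨hφ.continuous.continuousOn, deriv φ,
      fun t _ => hasDerivAt_iff_tendsto_slope_zero.1 (hd t).hasDerivAt, ih hφ'⟩

/-- A point of an open set `J` of reals has a smooth map `ℝ → J` which is the identity near it. -/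
theorem exists_smooth_localization {J : Set ℝ} (hJ : IsOpen J) {t : ℝ} (ht : t ∈ J) :
    ∃ φ : ℝ → ℝ, SmoothCurve φ ∧ (∀ s, φ s ∈ J) ∧
      ∃ K, IsOpen K ∧ t ∈ K ∧ K ⊆ J ∧ ∀ s ∈ K, φ s = s := by
  obtain ⟨ε, hε, hball⟩ := Metric.isOpen_iff.1 hJ t ht
  let χ : ContDiffBump t := ⟨ε / 2, ε, half_pos hε, half_lt_self hε⟩
  -- The bump contracts the line towards `t`: inside the `ε`-ball distances to `t` do not grow,
  -- outside everything goes to `t`.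
  refine ⟨fun s => t + χ s * (s - t), ContDiff.smoothCurve ?_, fun s => hball ?_,
    Metric.ball t (ε / 2), Metric.isOpen_ball, Metric.mem_ball_self (half_pos hε),
    (Metric.ball_subset_ball (half_lt_self hε).le).trans hball, fun s hs => ?_⟩
  · exact contDiff_const.add (χ.contDiff.mul (contDiff_id.sub contDiff_const))
  · rw [Metric.mem_ball, Real.dist_eq, add_sub_cancel_left, abs_mul, abs_of_nonneg χ.nonneg]
    by_cases hs : |s - t| < ε
    · exact (mul_le_of_le_one_left (abs_nonneg _) χ.le_one).trans_lt hs
    · have : χ s = 0 := χ.zero_of_le_dist (by simpa [Real.dist_eq, χ] using hs)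
      simpa [this] using hε
  · have : χ s = 1 := χ.one_of_mem_closedBall (Metric.ball_subset_closedBall hs)
    simp [this]

/-- Forms and trivializations are tested only on paths defined on all of `ℝ`; this brings a path
that stays in `U` only for `t ∈ J` within their reach. -/
theorem SmoothCurveOn.of_localization [T2Space E] {c : ℝ → E} {J : Set ℝ} (hJ : IsOpen J)
    (h : ∀ φ : ℝ → ℝ, SmoothCurve φ → (∀ s, φ s ∈ J) → SmoothCurve (c ∘ φ)) :
    SmoothCurveOn c J := by
  intro n
  refine CnCurveOn.of_locally fun t ht => ?_
  obtain ⟨φ, hφ, hφJ, K, hK, htK, hKJ, hid⟩ := exists_smooth_localization hJ ht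
  exact ⟨K, hK, htK, hKJ, ((h φ hφ hφJ n).mono (subset_univ K)).congr hK fun s hs => by
    simp [hid s hs]⟩

theorem SmoothCurveOn.comp_smoothCurve [IsTopologicalAddGroup E] [ContinuousSMul ℝ E] {φ : ℝ → ℝ}
    {c : ℝ → E} {J : Set ℝ} (hJ : IsOpen J) (hc : SmoothCurveOn c J) (hφ : SmoothCurve φ) :
    SmoothCurveOn (c ∘ φ) (φ ⁻¹' J) :=
  fun n => (hc n).comp hJ (hφ n)

theorem SmoothCurve.continuous {c : ℝ → E} (hc : SmoothCurve c) : Continuous c :=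
  continuousOn_univ.1 (hc 0)

theorem SmoothCurveOn.map (L : E →L[ℝ] F) {c : ℝ → E} {J : Set ℝ} (h : SmoothCurveOn c J) :
    SmoothCurveOn (fun t => L (c t)) J :=
  fun n => (h n).map L

theorem SmoothCurveOn.congr {c d : ℝ → E} {J : Set ℝ} (hJ : IsOpen J) (h : SmoothCurveOn c J)
    (hcd : EqOn c d J) : SmoothCurveOn d J :=
  fun n => (h n).congr hJ hcd

end CurveCalculus

/-! ### Paths in the tangent bundle and its quotient -/

section Bundles

variable {E : Type u} [AddCommGroup E] [Module ℝ E] [TopologicalSpace E]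
variable {M : Type v} [TopologicalSpace M] [ChartedSpace E M]

theorem AdaptedTrivialization.quotCoord_mk
    {ξ : ∀ x : M, Submodule ℝ (KTangentSpace E x)} (T : AdaptedTrivialization ξ) {x : M} (hx : x ∈ T.U) (w : KTangentSpace E x) :
    T.quotCoord x (Submodule.Quotient.mk w) = Submodule.Quotient.mk (T.triv x w) := by
  rw [quotCoord, dif_pos hx]
  rfl

variable [ConvenientSpace E]

instance (x : M) : IsTopologicalAddGroup (KTangentSpace E x) :=
  inferInstanceAs (IsTopologicalAddGroup E)
instance (x : M) : ContinuousSMul ℝ (KTangentSpace E x) := inferInstanceAs (ContinuousSMul ℝ E)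

theorem SmoothPath.comp {γ : ℝ → M} (hγ : SmoothPath E γ) {φ : ℝ → ℝ} (hφ : SmoothCurve φ) :
    SmoothPath E (γ ∘ φ) :=
  ⟨hγ.1.comp hφ.continuous, fun e he =>
    (hγ.2 e he).comp_smoothCurve (e.open_source.preimage hγ.1) hφ⟩

theorem SmoothTangentPath.comp {X : ℝ → KTangentBundle E M} (hX : SmoothTangentPath X)
    {φ : ℝ → ℝ} (hφ : SmoothCurve φ) : SmoothTangentPath (X ∘ φ) :=
  ⟨hX.1.comp hφ, fun e he =>
    (hX.2 e he).comp_smoothCurve (e.open_source.preimage hX.1.1) hφ⟩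

/-! ### Paths and forms in an adapted trivialization -/

namespace AdaptedTrivialization

variable {ξ : ∀ x : M, Submodule ℝ (KTangentSpace E x)} (T : AdaptedTrivialization ξ)

theorem isClosed_fibre {x : M} (hx : x ∈ T.U) : IsClosed (ξ x : Set (KTangentSpace E x)) := by
  have h : (ξ x : Set (KTangentSpace E x)) = T.triv x ⁻¹' (T.F : Set E) := by
    ext w
    exact T.mem_iff x hx w
  rw [h]
  exact T.complemented_F.isClosed.preimage (T.triv x).continuous

theorem smoothCurveOn_triv {X : ℝ → KTangentBundle E M} (hX : SmoothTangentPath X) :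
    SmoothCurveOn (fun t => T.triv (X t).proj (X t).snd) {t | (X t).proj ∈ T.U} :=
  SmoothCurveOn.of_localization (T.isOpen_U.preimage hX.1.1) fun _ hφ hφU =>
    (T.smooth_iff _ (hX.1.comp hφ) hφU).1 (hX.comp hφ)

theorem smoothCurveOn_oneForm (α : KOneForm E M) {γ : ℝ → M} (hγ : SmoothPath E γ) {c : ℝ → E}
    (hc : SmoothCurveOn c (γ ⁻¹' T.U)) :
    SmoothCurveOn (fun t => α.toFun (γ t) ((T.triv (γ t)).symm (c t))) (γ ⁻¹' T.U) := by
  have hU : IsOpen (γ ⁻¹' T.U) := T.isOpen_U.preimage hγ.1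
  refine SmoothCurveOn.of_localization hU fun φ hφ hφU => ?_
  let X : ℝ → KTangentBundle E M := fun t => ⟨γ (φ t), (T.triv (γ (φ t))).symm (c (φ t))⟩
  refine α.smooth X ((T.smooth_iff X (hγ.comp hφ) hφU).2 ?_)
  have h := hc.comp_smoothCurve hU hφ
  rw [show φ ⁻¹' (γ ⁻¹' T.U) = univ from eq_univ_of_forall hφU] at h
  simpa [X, SmoothCurve, Function.comp_def] using h

/-- A continuous linear section of the quotient map onto the model fibre. -/
theorem exists_section : ∃ s : (E ⧸ T.F) →L[ℝ] E, ∀ q, Submodule.Quotient.mk (s q) = q := by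
  obtain ⟨p, hp⟩ := T.complemented_F
  -- For a projection `p` onto `F`, `id - p` kills `F` and changes vectors only by elements of `F`,
  -- so it descends to a section.
  let l : E →L[ℝ] E := ContinuousLinearMap.id ℝ E - T.F.subtypeL.comp p
  have hl : T.F ≤ l.toLinearMap.ker := fun w hw => by
    have : p w = ⟨w, hw⟩ := hp ⟨w, hw⟩
    simp [l, this]
  refine ⟨⟨T.F.liftQ l.toLinearMap hl, ?_⟩, fun q => ?_⟩
  · exact continuous_quot_lift _ l.continuous
  · induction q using Submodule.Quotient.induction_on with
    | H w => simp [l]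

end AdaptedTrivialization

theorem KOneForm.smoothQuotPath_mk_iff {ξ : KDistribution E M} (α : KOneForm E M)
    (hα : ∀ x : M, α.toFun x ≠ 0) (hker : ∀ x : M, ξ.fibre x = (α.toFun x).ker) {γ : ℝ → M}
    (hγ : SmoothPath E γ) (w : ∀ t, KTangentSpace E (γ t)) :
    ξ.SmoothQuotPath γ (fun t => Submodule.Quotient.mk (w t)) ↔
      SmoothCurve (fun t => α.toFun (γ t) (w t)) := by
  have hmem : ∀ x v, v ∈ ξ.fibre x ↔ α.toFun x v = 0 := fun x v => by
    rw [hker x]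
    exact LinearMap.mem_ker
  constructor
  · rintro ⟨-, hy⟩ n
    refine CnCurveOn.of_locally fun t _ => ?_
    obtain ⟨T, hT⟩ := ξ.locally_trivial (γ t)
    obtain ⟨s, hs⟩ := T.exists_section
    have hU : IsOpen (γ ⁻¹' T.U) := T.isOpen_U.preimage hγ.1
    refine ⟨γ ⁻¹' T.U, hU, hT, subset_univ _,
      (T.smoothCurveOn_oneForm α hγ ((hy T).map s)).congr hU (fun r hr => ?_) n⟩
    -- The lifted class and `triv w` differ by an element of `F`, which `triv` pulls back into `ker
    -- α`; hence `α` takes the same value on both.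
    have h := hs (T.quotCoord (γ r) (Submodule.Quotient.mk (w r)))
    conv_rhs at h => rw [T.quotCoord_mk hr]
    rw [Submodule.Quotient.eq] at h
    have h' := (T.mem_iff (γ r) hr ((T.triv (γ r)).symm (_ - _))).2
      (by rwa [ContinuousLinearEquiv.apply_symm_apply])
    rw [hmem, map_sub, map_sub, ContinuousLinearEquiv.symm_apply_apply] at h'
    exact sub_eq_zero.1 h'
  · refine fun ha => ⟨hγ, fun T n => ?_⟩
    have hU : IsOpen (γ ⁻¹' T.U) := T.isOpen_U.preimage hγ.1
    rcases (γ ⁻¹' T.U).eq_empty_or_nonempty with hempty | ⟨t₀, ht₀⟩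
    · rw [hempty]
      exact (CnCurveOn.const n 0 ∅).congr isOpen_empty (fun _ h => h.elim)
    obtain ⟨v₀, hv₀⟩ : ∃ v, α.toFun (γ t₀) v ≠ 0 := by
      by_contra! h
      exact hα _ (ContinuousLinearMap.ext h)
    -- One vector outside `F` serves over all of `U`, since `F` does not depend on the point.
    set e₀ : E := T.triv (γ t₀) v₀
    have he₀ : e₀ ∉ T.F := fun h => hv₀ ((hmem _ _).1 ((T.mem_iff _ ht₀ _).2 h))
    set b : ℝ → ℝ := fun t => α.toFun (γ t) ((T.triv (γ t)).symm e₀)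
    have hb : SmoothCurveOn b (γ ⁻¹' T.U) :=
      T.smoothCurveOn_oneForm α hγ fun n => CnCurveOn.const n e₀ _
    have hb0 : ∀ t ∈ γ ⁻¹' T.U, b t ≠ 0 := fun t ht h => he₀ <| by
      have := (T.mem_iff _ ht _).1 ((hmem _ _).2 h)
      rwa [ContinuousLinearEquiv.apply_symm_apply] at this
    refine ((((ha n).mono (subset_univ _)).smul hU ((hb n).inv hU hb0)).smul hU
      (CnCurveOn.const n (Submodule.Quotient.mk e₀ : E ⧸ T.F) _)).congr hU fun t ht => ?_
    -- Modulo `ξ`, `w` is the multiple of `triv⁻¹ e₀` on which `α` has the same value.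
    have hw : (α.toFun (γ t) (w t) * (b t)⁻¹) • (T.triv (γ t)).symm e₀ - w t ∈ ξ.fibre (γ t) := by
      rw [hmem, map_sub, map_smul, smul_eq_mul]
      change _ * b t - _ = 0
      rw [inv_mul_cancel_right₀ (hb0 t ht), sub_self]
    have := (T.mem_iff _ ht _).1 hw
    rw [map_sub, map_smul, ContinuousLinearEquiv.apply_symm_apply] at this
    simp only [smul_eq_mul]
    rw [T.quotCoord_mk ht, ← Submodule.Quotient.mk_smul, Submodule.Quotient.eq]
    exact this

/-! ### The two implications -/

namespace KDistribution

variable (ξ : KDistribution E M)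

/-- Hausdorffness makes linear isomorphisms between these one-dimensional spaces automatically
continuous. -/
theorem t2Space_quot (x : M) : T2Space (ξ.Quot x) := by
  obtain ⟨T, hT⟩ := ξ.locally_trivial x
  have := T.isClosed_fibre hT
  infer_instance

theorem smoothQuotPath_mk {X : ℝ → KTangentBundle E M} (hX : SmoothTangentPath X) :
    ξ.SmoothQuotPath (fun t => (X t).proj) (fun t => Submodule.Quotient.mk (X t).snd) :=
  ⟨hX.1, fun T => ((T.smoothCurveOn_triv hX).map T.F.mkQL).congr (T.isOpen_U.preimage hX.1.1)
    fun _ ht => (T.quotCoord_mk ht _).symm⟩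

theorem CoOrientable.exists_oneForm {ξ : KDistribution E M} (h : ξ.CoOrientable)
    (hξ : ∀ x : M, Module.finrank ℝ (ξ.Quot x) = 1) :
    ∃ α : KOneForm E M, (∀ x, α.toFun x ≠ 0) ∧ ∀ x, ξ.fibre x = (α.toFun x).ker := by
  obtain ⟨G, _, _, _, _, _, ⟨Φ⟩⟩ := h
  -- A point of `M` is needed to learn anything about `G`.
  rcases isEmpty_or_nonempty M with hM | ⟨⟨x₀⟩⟩
  · exact ⟨⟨fun _ => 0, fun X _ => (hM.false (X 0).proj).elim⟩, fun x => (hM.false x).elim,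
      fun x => (hM.false x).elim⟩
  have := ξ.t2Space_quot x₀
  have : T2Space G := (Φ.equiv x₀).toHomeomorph.t2Space
  have hG : Module.finrank ℝ G = 1 := by
    rw [← (Φ.equiv x₀).toLinearEquiv.finrank_eq, hξ x₀]
  have : FiniteDimensional ℝ G := Module.finite_of_finrank_eq_succ hG
  let l : G ≃L[ℝ] ℝ := ContinuousLinearEquiv.ofFinrankEq (by simp [hG])
  let a : ∀ x : M, KTangentSpace E x →L[ℝ] ℝ := fun x =>
    (l.toContinuousLinearMap.comp (Φ.equiv x).toContinuousLinearMap).comp (ξ.fibre x).mkQL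
  have hker : ∀ x, ξ.fibre x = (a x).ker := fun x => by
    ext v
    simp [a]
  refine ⟨⟨a, fun X hX => SmoothCurveOn.map l.toContinuousLinearMap
    ((Φ.smooth_iff _ _ hX.1).1 (ξ.smoothQuotPath_mk hX))⟩, fun x hx => ?_, hker⟩
  have htop : ξ.fibre x = ⊤ := by
    rw [hker x]
    change a x = 0 at hx
    rw [hx]
    exact LinearMap.ker_zero
  have h1 := hξ x
  have : Subsingleton (ξ.Quot x) := Submodule.Quotient.subsingleton_iff.2 htop
  rw [Module.finrank_zero_of_subsingleton] at h1
  exact zero_ne_one h1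

theorem coOrientable_of_oneForm {ξ : KDistribution E M}
    (hξ : ∀ x : M, Module.finrank ℝ (ξ.Quot x) = 1) (α : KOneForm E M)
    (hα : ∀ x, α.toFun x ≠ 0) (hker : ∀ x, ξ.fibre x = (α.toFun x).ker) :
    ξ.CoOrientable := by
  have hsurj : ∀ x, Function.Surjective (α.toFun x).toLinearMap := fun x =>
    LinearMap.surjective fun h => hα x (ContinuousLinearMap.coe_injective h)
  let e : ∀ x, ξ.Quot x ≃ₗ[ℝ] ℝ := fun x =>
    (Submodule.quotEquivOfEq _ _ (hker x)).trans
      ((α.toFun x).toLinearMap.quotKerEquivOfSurjective (hsurj x))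
  -- `ULift` places the line in the universe required of `G`.
  let e' : ∀ x, ξ.Quot x ≃L[ℝ] ULift.{u} ℝ := fun x =>
    haveI := ξ.t2Space_quot x
    haveI : FiniteDimensional ℝ (ξ.Quot x) := Module.finite_of_finrank_eq_succ (hξ x)
    (e x).toContinuousLinearEquiv.trans ContinuousLinearEquiv.ulift.symm
  refine ⟨ULift.{u} ℝ, inferInstance, inferInstance, inferInstance, inferInstance, inferInstance,
    ⟨⟨e', fun γ y hγ => ?_⟩⟩⟩
  -- Arbitrary representatives suffice: the criterion asks no regularity of `w`.
  obtain ⟨w, rfl⟩ : ∃ w : ∀ t, KTangentSpace E (γ t), (fun t => Submodule.Quotient.mk (w t)) = y :=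
    ⟨fun t => (y t).out, funext fun t => Quotient.out_eq _⟩
  rw [α.smoothQuotPath_mk_iff hα hker hγ w]
  let u : ULift.{u} ℝ ≃L[ℝ] ℝ := ContinuousLinearEquiv.ulift
  exact ⟨fun h => SmoothCurveOn.map u.symm.toContinuousLinearMap h,
    fun h => SmoothCurveOn.map u.toContinuousLinearMap h⟩

end KDistribution

end Bundles

theorem mainTheorem11 {E : Type u} [AddCommGroup E] [Module ℝ E] [TopologicalSpace E]
    [ConvenientSpace E] {M : Type v} [TopologicalSpace M] [ChartedSpace E M]
    [ConvenientManifold E M] (ξ : KDistribution E M)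
    (hξ : ∀ x : M, Module.finrank ℝ (KTangentSpace E x ⧸ ξ.fibre x) = 1) :
    ξ.CoOrientable ↔
      ∃ α : KOneForm E M,
        (∀ x : M, α.toFun x ≠ 0) ∧ ∀ x : M, ξ.fibre x = (α.toFun x).ker :=
  ⟨fun h => h.exists_oneForm hξ, fun ⟨α, hα, hker⟩ =>
    KDistribution.coOrientable_of_oneForm hξ α hα hker⟩
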